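/- Let $\mathcal{H}$ be a real or complex Hilbert space and let $A$ be a self-adjoint operator on $\mathcal{H}$, densely defined and possibly unbounded, with $\langle\psi,A\psi\rangle\geqslant 0$ for all $\psi\in\mathcal{D}(A)$. Let $C^\infty(A)=\bigcap_{n}\mathcal{D}(A^n)$, let $g\in\mathrm{ran}\,A\cap C^\infty(A)$, $f^{[0]}\in C^\infty(A)$ and $\theta\geqslant 0$. Denote by $\mathcal{S}=\{f\in\mathcal{D}(A)\,|\,Af=g\}$ the (non-empty, closed, convex) solution manifold, and by $P_{\mathcal{S}}x$ the point of $\mathcal{S}$ closest to $x\in\mathcal{H}$. For $N\geqslant 1$ the $N$-th $\theta$-iterate $f^{[N]}$ is the minimiser of $$\|A^{\theta/2}(h-P_{\mathcal{S}}h)\|\quad\text{over}\quad h\in f^{[0]}+\mathrm{span}\{\mathfrak{R}_0,A\mathfrak{R}_0,\dots,A^{N-1}\mathfrak{R}_0\},\qquad \mathfrak{R}_0=Af^{[0]}-g .$$ These iterates are well defined: for each $N\geqslant 1$ all the vectors $h-P_{\mathcal{S}}h$ in the minimisation belong to $\mathcal{D}(A^{\theta/2})$, and the minimiser exists and is unique.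 Moreover: 1. $f^{[N]}-P_{\mathcal{S}}f^{[N]}\in(\ker A)^\perp$ for all $N\geqslant 0$; 2. $P_{\mathcal{S}}f^{[N]}=P_{\mathcal{S}}f^{[0]}$ for all $N\geqslant 1$; 3. for every $N\geqslant 1$ there is a polynomial $p_N$ with real coefficients, of degree at most $N$ and with $p_N(0)=1$, such that $f^{[0]}-P_{\mathcal{S}}f^{[0]}\in\mathcal{D}(p_N(A))$ and $$f^{[N]}-P_{\mathcal{S}}f^{[N]}=p_N(A)\,(f^{[0]}-P_{\mathcal{S}}f^{[0]}).$$ -/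

import Mathlib

open Filter Topology MeasureTheory

noncomputable section

namespace UnboundedOp

variable {𝕜 : Type*} [RCLike 𝕜] {H : Type*} [NormedAddCommGroup H] [InnerProductSpace 𝕜 H]

open Classical in
/-- The vector `B x` if `x` lies in the domain of `B`, and `0` otherwise. -/
def val (B : H →ₗ.[𝕜] H) (x : H) : H :=
  if h : x ∈ B.domain then B ⟨x, h⟩ else 0

theorem val_of_mem (B : H →ₗ.[𝕜] H) {x : H} (h : x ∈ B.domain) : val B x = B ⟨x, h⟩ :=
  dif_pos h

theorem val_add (B : H →ₗ.[𝕜] H) {x y : H} (hx : x ∈ B.domain) (hy : y ∈ B.domain) :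
    val B (x + y) = val B x + val B y := by
  rw [val_of_mem B hx, val_of_mem B hy, val_of_mem B (B.domain.add_mem hx hy), ← B.map_add]
  rfl

theorem val_smul (B : H →ₗ.[𝕜] H) (c : 𝕜) {x : H} (hx : x ∈ B.domain) :
    val B (c • x) = c • val B x := by
  rw [val_of_mem B hx, val_of_mem B (B.domain.smul_mem c hx), ← B.map_smul]
  rfl

theorem val_zero (B : H →ₗ.[𝕜] H) : val B 0 = 0 := by
  rw [val_of_mem B B.domain.zero_mem]
  exact B.map_zero

/-- The set of `x ∈ D(A)` with `A x ∈ D(B)`. -/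
def compDomain (B A : H →ₗ.[𝕜] H) : Submodule 𝕜 H :=
  (B.domain.comap A.toFun).map A.domain.subtype

/-- The product `B A` of two operators, with domain `{x ∈ D(A) | A x ∈ D(B)}`. -/
def comp (B A : H →ₗ.[𝕜] H) : H →ₗ.[𝕜] H :=
  B.comp (A.domRestrict (compDomain B A)) (by
    rintro ⟨x, hx, hxA⟩
    obtain ⟨y, hy, rfl⟩ := hx
    exact hy)

/-- The powers `A ^ n` on their natural domains. -/
def npow (A : H →ₗ.[𝕜] H) : ℕ → (H →ₗ.[𝕜] H)
  | 0 => (LinearMap.id : H →ₗ[𝕜] H).toPMap ⊤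
  | n + 1 => comp A (npow A n)

/-- The space `C^∞(A) = ⋂ₙ D(A ^ n)` of `A`-smooth vectors. -/
def smoothVectors (A : H →ₗ.[𝕜] H) : Submodule 𝕜 H := ⨅ n : ℕ, (npow A n).domain

/-- `ker A`, as a subspace of `H`. -/
def ker (A : H →ₗ.[𝕜] H) : Submodule 𝕜 H := (LinearMap.ker A.toFun).map A.domain.subtype

/-- `ran A`. -/
def ran (A : H →ₗ.[𝕜] H) : Submodule 𝕜 H := LinearMap.range A.toFun

/-- `A` is non-negative: `⟨ψ, A ψ⟩ ≥ 0` for `ψ ∈ D(A)`.  (For self-adjoint `A` the number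
`⟨ψ, A ψ⟩` is automatically real.) -/
def IsNonneg (A : H →ₗ.[𝕜] H) : Prop :=
  ∀ x : A.domain, 0 ≤ RCLike.re (inner 𝕜 (x : H) (A x))

/-- `p(A) = ∑ₖ pₖ A ^ k`, on the intersection of the domains of the powers that occur. -/
def polyOp (p : Polynomial ℝ) (A : H →ₗ.[𝕜] H) : H →ₗ.[𝕜] H :=
  p.sum fun k a => (a : 𝕜) • npow A k

/-- The operator `A (t + A)⁻¹`. -/
def resolventPart (A : H →ₗ.[𝕜] H) (t : ℝ) : H →ₗ.[𝕜] H :=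
  comp A (((t : 𝕜) • (LinearMap.id : H →ₗ[𝕜] H)) +ᵥ A).inverse

/-- The integrand `t ^ (α - 1) A (t + A)⁻¹ x` of the Balakrishnan formula. -/
def balakrishnanIntegrand (A : H →ₗ.[𝕜] H) (α : ℝ) (x : H) (t : ℝ) : H :=
  ((t ^ (α - 1) : ℝ) : 𝕜) • val (resolventPart A t) x

/-- `∫₀ᴿ t ^ (α - 1) A (t + A)⁻¹ x dt`, a Bochner integral. -/
def balakrishnanIntegral (A : H →ₗ.[𝕜] H) (α : ℝ) (x : H) (R : ℝ) : H :=
  letI : NormedSpace ℝ H := NormedSpace.restrictScalars ℝ 𝕜 H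
  ∫ t in Set.Ioc (0 : ℝ) R, balakrishnanIntegrand A α x t

/-- `x` is in the domain of `A ^ α` for `0 < α < 1`: the Balakrishnan integral over `(0, ∞)`
converges in norm, as an improper integral at `∞`.  (For `A` self-adjoint and non-negative the
first two clauses hold for every `x`, and by the spectral theorem the third one says that
`∫ λ ^ (2 α) d⟨x, E(λ) x⟩ < ∞`.) -/
def MemFracDomain (A : H →ₗ.[𝕜] H) (α : ℝ) (x : H) : Prop :=
  (∀ t : ℝ, 0 < t → x ∈ (resolventPart A t).domain) ∧
  (∀ R : ℝ, IntegrableOn (balakrishnanIntegrand A α x) (Set.Ioc 0 R)) ∧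
  ∃ y, Tendsto (balakrishnanIntegral A α x) atTop (𝓝 y)

theorem balakrishnanIntegrand_add (A : H →ₗ.[𝕜] H) (α : ℝ) {x y : H}
    (hx : ∀ t : ℝ, 0 < t → x ∈ (resolventPart A t).domain)
    (hy : ∀ t : ℝ, 0 < t → y ∈ (resolventPart A t).domain) (R : ℝ) :
    Set.EqOn (balakrishnanIntegrand A α (x + y))
      (balakrishnanIntegrand A α x + balakrishnanIntegrand A α y) (Set.Ioc 0 R) := by
  intro t ht
  simp only [balakrishnanIntegrand, Pi.add_apply]
  rw [val_add _ (hx t ht.1) (hy t ht.1), smul_add]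

theorem balakrishnanIntegrand_smul (A : H →ₗ.[𝕜] H) (α : ℝ) (c : 𝕜) {x : H}
    (hx : ∀ t : ℝ, 0 < t → x ∈ (resolventPart A t).domain) (R : ℝ) :
    Set.EqOn (balakrishnanIntegrand A α (c • x))
      (c • balakrishnanIntegrand A α x) (Set.Ioc 0 R) := by
  intro t ht
  simp only [balakrishnanIntegrand, Pi.smul_apply]
  rw [val_smul _ c (hx t ht.1), smul_comm]

theorem balakrishnanIntegral_add (A : H →ₗ.[𝕜] H) (α : ℝ) {x y : H}
    (hx : MemFracDomain A α x) (hy : MemFracDomain A α y) :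
    balakrishnanIntegral A α (x + y) =
      balakrishnanIntegral A α x + balakrishnanIntegral A α y := by
  let _ : NormedSpace ℝ H := NormedSpace.restrictScalars ℝ 𝕜 H
  funext R
  simp only [balakrishnanIntegral, Pi.add_apply]
  rw [setIntegral_congr_fun measurableSet_Ioc (balakrishnanIntegrand_add A α hx.1 hy.1 R)]
  exact integral_add (hx.2.1 R) (hy.2.1 R)

theorem balakrishnanIntegral_smul (A : H →ₗ.[𝕜] H) (α : ℝ) (c : 𝕜) {x : H}
    (hx : MemFracDomain A α x) :
    balakrishnanIntegral A α (c • x) = c • balakrishnanIntegral A α x := by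
  let _ : NormedSpace ℝ H := NormedSpace.restrictScalars ℝ 𝕜 H
  have : IsScalarTower ℝ 𝕜 H := RestrictScalars.isScalarTower ℝ 𝕜 H
  funext R
  simp only [balakrishnanIntegral, Pi.smul_apply]
  rw [setIntegral_congr_fun measurableSet_Ioc (balakrishnanIntegrand_smul A α c hx.1 R)]
  exact integral_smul c _

theorem balakrishnanIntegral_zero (A : H →ₗ.[𝕜] H) (α : ℝ) :
    balakrishnanIntegral A α (0 : H) = 0 := by
  funext R
  simp [balakrishnanIntegral, balakrishnanIntegrand, val_zero]

/-- The fractional power `A ^ α`, `0 < α < 1`, given by the Balakrishnan formula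
`A ^ α x = (sin (π α) / π) ∫₀^∞ t ^ (α - 1) A (t + A)⁻¹ x dt`. -/
def fracPow (A : H →ₗ.[𝕜] H) (α : ℝ) : H →ₗ.[𝕜] H where
  domain :=
    { carrier := {x | MemFracDomain A α x}
      zero_mem' := by
        refine ⟨fun t _ => Submodule.zero_mem _, fun R => ?_, 0, ?_⟩
        · have : balakrishnanIntegrand A α (0 : H) = fun _ => 0 := by
            funext t
            simp [balakrishnanIntegrand, val_zero]
          rw [this]
          exact integrableOn_zero
        · rw [balakrishnanIntegral_zero]
          exact tendsto_const_nhds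
      add_mem' := by
        intro x y hx hy
        refine ⟨fun t ht => Submodule.add_mem _ (hx.1 t ht) (hy.1 t ht), fun R => ?_, ?_⟩
        · exact ((hx.2.1 R).add (hy.2.1 R)).congr_fun
            (balakrishnanIntegrand_add A α hx.1 hy.1 R).symm measurableSet_Ioc
        · obtain ⟨u, hu⟩ := hx.2.2
          obtain ⟨v, hv⟩ := hy.2.2
          refine ⟨u + v, ?_⟩
          rw [balakrishnanIntegral_add A α hx hy]
          exact hu.add hv
      smul_mem' := by
        intro c x hx
        refine ⟨fun t ht => Submodule.smul_mem _ c (hx.1 t ht), fun R => ?_, ?_⟩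
        · have hI : IntegrableOn (c • balakrishnanIntegrand A α x) (Set.Ioc 0 R) :=
            (hx.2.1 R).smul c
          exact hI.congr_fun (balakrishnanIntegrand_smul A α c hx.1 R).symm measurableSet_Ioc
        · obtain ⟨u, hu⟩ := hx.2.2
          refine ⟨c • u, ?_⟩
          rw [balakrishnanIntegral_smul A α c hx]
          exact hu.const_smul c }
  toFun :=
    { toFun := fun x => ((Real.sin (Real.pi * α) / Real.pi : ℝ) : 𝕜) •
        limUnder atTop (balakrishnanIntegral A α (x : H))
      map_add' := by
        rintro ⟨x, hx⟩ ⟨y, hy⟩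
        obtain ⟨u, hu⟩ := hx.2.2
        obtain ⟨v, hv⟩ := hy.2.2
        change _ • limUnder atTop (balakrishnanIntegral A α (x + y)) = _
        rw [balakrishnanIntegral_add A α hx hy, ← smul_add, hu.limUnder_eq, hv.limUnder_eq]
        exact congrArg _ (hu.add hv).limUnder_eq
      map_smul' := by
        rintro c ⟨x, hx⟩
        obtain ⟨u, hu⟩ := hx.2.2
        change _ • limUnder atTop (balakrishnanIntegral A α (c • x)) = _
        rw [balakrishnanIntegral_smul A α c hx, RingHom.id_apply, hu.limUnder_eq, smul_comm c]
        exact congrArg _ (hu.const_smul c).limUnder_eq }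

/-- The power `A ^ s`, `s ≥ 0`, of a non-negative self-adjoint operator `A`: the power `A ^ n` if
`s = n` is an integer (in particular `A ^ 0` is the identity), and `A ^ α A ^ n` if `s = n + α`
with `n` an integer and `0 < α < 1`. -/
def rpow (A : H →ₗ.[𝕜] H) (s : ℝ) : H →ₗ.[𝕜] H :=
  if Int.fract s = 0 then npow A ⌊s⌋₊ else comp (fracPow A (Int.fract s)) (npow A ⌊s⌋₊)

/-- The solution manifold `S = {f ∈ D(A) | A f = g}`. -/
def solutionSet (A : H →ₗ.[𝕜] H) (g : H) : Set H := {f | ∃ h : f ∈ A.domain, A ⟨f, h⟩ = g}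

/-- The projection onto a non-empty closed convex set `S`: the point of `S` closest to `x`. -/
def proj (S : Set H) (x : H) : H :=
  Classical.epsilon fun y => y ∈ S ∧ ∀ z ∈ S, ‖x - y‖ ≤ ‖x - z‖

/-- The vector `x - P_S x`, for `S` the solution manifold of `A f = g`. -/
def err (A : H →ₗ.[𝕜] H) (g x : H) : H := x - proj (solutionSet A g) x

/-- The Krylov space `K_N(A, r) = span {r, A r, …, A ^ (N - 1) r}`. -/
def krylov (A : H →ₗ.[𝕜] H) (r : H) (N : ℕ) : Submodule 𝕜 H :=
  Submodule.span 𝕜 {v | ∃ k < N, v = val (npow A k) r}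

/-- The affine space `f₀ + K_N(A, A f₀ - g)`. -/
def searchSpace (A : H →ₗ.[𝕜] H) (g f₀ : H) (N : ℕ) : Set H :=
  {h | h - f₀ ∈ krylov A (val A f₀ - g) N}

/-- `f` is the sequence of `θ`-iterates for `A f = g` with initial guess `f₀`: `f 0 = f₀`, and for
every `N ≥ 1`, `f N` minimises `‖A ^ (θ / 2) (h - P_S h)‖` over `h ∈ f₀ + K_N(A, A f₀ - g)`, where
`h - P_S h` is in the domain of `A ^ (θ / 2)` for all these `h`. -/
def IsThetaIterates (A : H →ₗ.[𝕜] H) (g f₀ : H) (θ : ℝ) (f : ℕ → H) : Prop :=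
  f 0 = f₀ ∧ ∀ N : ℕ, 1 ≤ N →
    (∀ h ∈ searchSpace A g f₀ N, err A g h ∈ (rpow A (θ / 2)).domain) ∧
    f N ∈ searchSpace A g f₀ N ∧
    ∀ h ∈ searchSpace A g f₀ N,
      ‖val (rpow A (θ / 2)) (err A g (f N))‖ ≤ ‖val (rpow A (θ / 2)) (err A g h)‖

end UnboundedOp

end

/-!
The solution manifold is a translate of `ker A`, so `P_S` is characterised by `x - P_S x ⟂ ker A`.
The residual `A f₀ - g` equals `A e` with `e = f₀ - P_S f₀`, hence the Krylov directions lie in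
`ran A`, which is orthogonal to `ker A`; moving `f₀` along them leaves `P_S f₀` unchanged and adds
the same vector to the error. The minimisation therefore reads `‖B (e + k)‖ → min` with
`B = A ^ (θ / 2)` and `k` in a finite-dimensional Krylov space, a least squares problem that has a
unique solution because `B` is injective on `(ker A)ᗮ`. The vectors `e + k` are exactly the
`p(A) e` with `deg p ≤ N` and `p(0) = 1`. Since `A` is symmetric and commutes with `B`, conjugating
the coefficients of `p` does not change `‖B p(A) e‖`, so by uniqueness `p` may be taken real.

What is needed of the fractional powers (domain, commutation with `A`, kernel) is read off the
Balakrishnan integral: `A (t + A)⁻¹` is a contraction commuting with `A`, and the integrand paired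
with `x` is nonnegative, vanishing only for `x ∈ ker A`.
-/

noncomputable section

namespace UnboundedOp

open Polynomial ComplexConjugate

section Minimisation

variable {𝕜 V E : Type*} [RCLike 𝕜] [AddCommGroup V] [Module 𝕜 V]
  [NormedAddCommGroup E] [InnerProductSpace 𝕜 E]

theorem norm_le_norm_add_of_inner_eq_zero {u v : E} (h : inner 𝕜 u v = 0) : ‖u‖ ≤ ‖u + v‖ := by
  have pythagoras := norm_add_sq_eq_norm_sq_add_norm_sq_of_inner_eq_zero u v h
  nlinarith [norm_nonneg (u + v), norm_nonneg u, mul_self_nonneg ‖v‖]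

theorem eq_zero_of_norm_add_le_of_inner_eq_zero {u v : E} (h : inner 𝕜 u v = 0)
    (hle : ‖u + v‖ ≤ ‖u‖) : v = 0 := by
  have pythagoras := norm_add_sq_eq_norm_sq_add_norm_sq_of_inner_eq_zero u v h
  rw [← norm_eq_zero]
  nlinarith [norm_nonneg (u + v)]

theorem existsUnique_isMinOn_norm_map_add (B : V →ₗ[𝕜] E) {K : Submodule 𝕜 V}
    [(K.map B).HasOrthogonalProjection] (hB : Disjoint K (LinearMap.ker B)) (e : V) :
    ∃! k, k ∈ K ∧ IsMinOn (fun k => ‖B (e + k)‖) K k := by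
  obtain ⟨k, hk, hBk⟩ := (K.map B).starProjection_apply_mem (-B e)
  have orthogonal : ∀ k' ∈ K, inner 𝕜 (B (e + k)) (B (k' - k)) = 0 := fun k' hk' => by
    refine Submodule.inner_left_of_mem_orthogonal
      (Submodule.mem_map_of_mem (K.sub_mem hk' hk)) ?_
    rw [← Submodule.neg_mem_iff, map_add, hBk, neg_add, ← sub_eq_add_neg]
    exact (K.map B).sub_starProjection_mem_orthogonal (-B e)
  have split (k' : V) : B (e + k') = B (e + k) + B (k' - k) := by
    rw [← map_add, add_add_sub_cancel]
  refine ⟨k, ⟨hk, fun k' hk' => ?_⟩, fun k' hk' => ?_⟩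
  · change ‖B (e + k)‖ ≤ ‖B (e + k')‖
    rw [split k']
    exact norm_le_norm_add_of_inner_eq_zero (orthogonal k' hk')
  · have hle : ‖B (e + k')‖ ≤ ‖B (e + k)‖ := hk'.2 hk
    rw [split k'] at hle
    exact sub_eq_zero.1 (LinearMap.disjoint_ker.1 hB _ (K.sub_mem hk'.1 hk)
      (eq_zero_of_norm_add_le_of_inner_eq_zero (orthogonal k' hk'.1) hle))

end Minimisation

section Krylov

variable {𝕜 V : Type*} [Field 𝕜] [AddCommGroup V] [Module 𝕜 V]

/-- The Krylov space `{q(T) x | deg q < N}` of an endomorphism `T` of a vector space. -/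
def krylovSubspace (T : Module.End 𝕜 V) (x : V) (N : ℕ) : Submodule 𝕜 V :=
  (degreeLT 𝕜 N).map ((aeval T).toLinearMap.flip x)

instance (T : Module.End 𝕜 V) (x : V) (N : ℕ) : FiniteDimensional 𝕜 (krylovSubspace T x N) :=
  Module.Finite.map _ _

theorem krylovSubspace_eq_span (T : Module.End 𝕜 V) (x : V) (N : ℕ) :
    krylovSubspace T x N = Submodule.span 𝕜 ((fun k => (T ^ k) x) '' Set.Iio N) := by
  classical
  rw [krylovSubspace, degreeLT_eq_span_X_pow, Submodule.map_span, Finset.coe_image,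
    Finset.coe_range, Set.image_image]
  simp

theorem krylovSubspace_zero (T : Module.End 𝕜 V) (x : V) : krylovSubspace T x 0 = ⊥ := by
  simp [krylovSubspace_eq_span]

theorem mem_krylovSubspace_apply_iff {T : Module.End 𝕜 V} {e k : V} {N : ℕ} :
    k ∈ krylovSubspace T (T e) N ↔
      ∃ p : 𝕜[X], p.natDegree ≤ N ∧ p.eval 0 = 1 ∧ aeval T p e = e + k := by
  constructor
  · rintro ⟨q, hq, rfl⟩
    refine ⟨1 + q * X, ?_, by simp, by simp⟩
    refine natDegree_add_le_of_degree_le (by simp) ?_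
    rcases eq_or_ne q 0 with rfl | hq0
    · simp
    · rw [natDegree_mul_X hq0, Nat.succ_le_iff, natDegree_lt_iff_degree_lt hq0]
      exact mem_degreeLT.1 hq
  · rintro ⟨p, hdeg, hp0, hpe⟩
    have hp : p.divX * X + 1 = p := by
      conv_rhs => rw [← p.divX_mul_X_add, coeff_zero_eq_eval_zero, hp0, C_1]
    have hp_ne : p ≠ 0 := by
      rintro rfl
      simp at hp0
    refine ⟨p.divX, mem_degreeLT.2 ((degree_divX_lt hp_ne).trans_le
      (degree_le_of_natDegree_le hdeg)), ?_⟩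
    rw [← hp, map_add, map_mul, aeval_X, map_one, LinearMap.add_apply, Module.End.one_apply,
      add_comm] at hpe
    exact add_left_cancel hpe

end Krylov

section RealCoefficients

variable {𝕜 V E : Type*} [RCLike 𝕜] [AddCommGroup V] [Module 𝕜 V]
  [NormedAddCommGroup E] [InnerProductSpace 𝕜 E]
  {T : Module.End 𝕜 V} {B : V →ₗ[𝕜] E}

theorem exists_two_smul_map_algebraMap_eq_add_map_conj (p : 𝕜[X]) :
    ∃ q : ℝ[X], q.natDegree ≤ p.natDegree ∧
      (2 : 𝕜) • q.map (algebraMap ℝ 𝕜) = p + p.map conj := by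
  refine ⟨∑ k ∈ Finset.range (p.natDegree + 1), monomial k (RCLike.re (p.coeff k)), ?_, ?_⟩
  · exact natDegree_sum_le_of_forall_le _ _ fun k hk =>
      (natDegree_monomial_le _).trans (Finset.mem_range_succ_iff.1 hk)
  · ext k
    have hcoeff : k ∉ Finset.range (p.natDegree + 1) → p.coeff k = 0 := fun hk =>
      coeff_eq_zero_of_natDegree_lt (by simpa using hk)
    simp only [coeff_smul, coeff_map, finsetSum_coeff, coeff_monomial, Finset.sum_ite_eq',
      coeff_add, RCLike.add_conj, RCLike.algebraMap_eq_ofReal, smul_eq_mul]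
    split_ifs with hk
    · rfl
    · simp [hcoeff hk]

theorem inner_map_aeval_left (hT : ∀ x y, inner 𝕜 (B (T x)) (B y) = inner 𝕜 (B x) (B (T y)))
    (p : 𝕜[X]) (x y : V) :
    inner 𝕜 (B (aeval T p x)) (B y) = inner 𝕜 (B x) (B (aeval T (p.map conj) y)) := by
  induction p using Polynomial.induction_on generalizing x y with
  | C a => simp [inner_smul_left, inner_smul_right]
  | add p q hp hq => simp [inner_add_left, inner_add_right, hp, hq]
  | monomial n a ih =>
    rw [pow_succ, ← mul_assoc, Polynomial.map_mul, map_X, map_mul (aeval T) _ X, aeval_X,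
      Module.End.mul_apply, ih, hT, mul_comm _ X, map_mul (aeval T) X, aeval_X,
      Module.End.mul_apply]

theorem norm_map_aeval_map_conj
    (hT : ∀ x y, inner 𝕜 (B (T x)) (B y) = inner 𝕜 (B x) (B (T y))) (p : 𝕜[X]) (x : V) :
    ‖B (aeval T (p.map conj) x)‖ = ‖B (aeval T p x)‖ := by
  have h : inner 𝕜 (B (aeval T (p.map conj) x)) (B (aeval T (p.map conj) x)) =
      inner 𝕜 (B (aeval T p x)) (B (aeval T p x)) := by
    rw [inner_map_aeval_left hT, inner_map_aeval_left hT, ← Module.End.mul_apply,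
      ← Module.End.mul_apply, ← map_mul, ← map_mul, Polynomial.map_map, RingHomCompTriple.comp_eq,
      Polynomial.map_id, mul_comm]
  rw [inner_self_eq_norm_sq_to_K, inner_self_eq_norm_sq_to_K] at h
  exact (sq_eq_sq₀ (norm_nonneg _) (norm_nonneg _)).1 (by exact_mod_cast h)

/-- Conjugating the coefficients of a residual polynomial preserves the norm that is minimised, so
the unique minimiser is also given by the average of the two polynomials. -/
theorem exists_real_polynomial_of_isMinOn
    (hT : ∀ x y, inner 𝕜 (B (T x)) (B y) = inner 𝕜 (B x) (B (T y))) {e k : V} {N : ℕ}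
    (hB : Disjoint (krylovSubspace T (T e) N) (LinearMap.ker B))
    (hk : k ∈ krylovSubspace T (T e) N)
    (hmin : IsMinOn (fun k => ‖B (e + k)‖) (krylovSubspace T (T e) N) k) :
    ∃ p : ℝ[X], p.natDegree ≤ N ∧ p.eval 0 = 1 ∧
      aeval T (p.map (algebraMap ℝ 𝕜)) e = e + k := by
  obtain ⟨p, hdeg, hp0, hpe⟩ := mem_krylovSubspace_apply_iff.1 hk
  obtain ⟨k', hk'⟩ : ∃ k', aeval T (p.map conj) e = e + k' := ⟨_, (add_sub_cancel e _).symm⟩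
  have hmem : k' ∈ krylovSubspace T (T e) N := mem_krylovSubspace_apply_iff.2
    ⟨p.map conj, natDegree_map_le.trans hdeg, by rw [eval_zero_map, hp0, map_one], hk'⟩
  have hnorm : ‖B (e + k')‖ = ‖B (e + k)‖ := by
    rw [← hk', ← hpe, norm_map_aeval_map_conj hT]
  have hmin' : IsMinOn (fun k => ‖B (e + k)‖) (krylovSubspace T (T e) N) k' := fun l hl => by
    change ‖B (e + k')‖ ≤ ‖B (e + l)‖
    rw [hnorm]
    exact hmin hl
  obtain rfl : k' = k :=
    (existsUnique_isMinOn_norm_map_add B hB e).unique ⟨hmem, hmin'⟩ ⟨hk, hmin⟩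
  obtain ⟨q, hqdeg, hq⟩ := exists_two_smul_map_algebraMap_eq_add_map_conj p
  refine ⟨q, hqdeg.trans hdeg, ?_, ?_⟩
  · have heval := congrArg (eval 0) hq
    rw [eval_smul, eval_add, eval_zero_map, eval_zero_map, hp0, map_one, one_add_one_eq_two,
      smul_eq_mul, mul_eq_left₀ two_ne_zero] at heval
    exact (algebraMap ℝ 𝕜).injective (heval.trans (map_one _).symm)
  · refine smul_right_injective V (two_ne_zero (α := 𝕜)) ?_
    simp only
    rw [← LinearMap.smul_apply, ← map_smul, hq, map_add, LinearMap.add_apply, hpe, hk', two_smul]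

end RealCoefficients

section Powers

variable {𝕜 : Type*} [RCLike 𝕜] {H : Type*} [NormedAddCommGroup H] [InnerProductSpace 𝕜 H]
  {A B : H →ₗ.[𝕜] H}

theorem ext_val (hdom : A.domain = B.domain) (hval : ∀ x ∈ A.domain, val A x = val B x) : A = B :=
  LinearPMap.ext hdom fun x hA hB => by rw [← val_of_mem A hA, ← val_of_mem B hB, hval x hA]

theorem val_sub (A : H →ₗ.[𝕜] H) {x y : H} (hx : x ∈ A.domain) (hy : y ∈ A.domain) :
    val A (x - y) = val A x - val A y := by
  rw [val_of_mem A hx, val_of_mem A hy, val_of_mem A (A.domain.sub_mem hx hy), ← A.map_sub]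
  rfl

theorem mem_ker_iff {x : H} : x ∈ ker A ↔ x ∈ A.domain ∧ val A x = 0 := by
  simp only [ker, Submodule.mem_map, LinearMap.mem_ker]
  constructor
  · rintro ⟨y, hy, rfl⟩
    exact ⟨y.2, (val_of_mem A y.2).trans hy⟩
  · rintro ⟨hx, hx'⟩
    exact ⟨⟨x, hx⟩, (val_of_mem A hx).symm.trans hx', rfl⟩

theorem mem_comp_domain {x : H} : x ∈ (comp B A).domain ↔ x ∈ A.domain ∧ val A x ∈ B.domain := by
  change x ∈ compDomain B A ⊓ A.domain ↔ _
  simp only [compDomain, Submodule.mem_inf, Submodule.mem_map, Submodule.mem_comap]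
  constructor
  · rintro ⟨⟨y, hy, rfl⟩, -⟩
    refine ⟨y.2, ?_⟩
    rw [Submodule.subtype_apply, val_of_mem A y.2]
    exact hy
  · rintro ⟨hx, hAx⟩
    rw [val_of_mem A hx] at hAx
    exact ⟨⟨⟨x, hx⟩, hAx, rfl⟩, hx⟩

theorem val_comp {x : H} (hx : x ∈ (comp B A).domain) : val (comp B A) x = val B (val A x) := by
  obtain ⟨hxA, hAx⟩ := mem_comp_domain.1 hx
  rw [val_of_mem _ hx, val_of_mem _ hAx]
  exact congrArg B.toFun (Subtype.ext (val_of_mem A hxA).symm)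

theorem comp_assoc (A B C : H →ₗ.[𝕜] H) : comp (comp C B) A = comp C (comp B A) := by
  refine ext_val ?_ fun x hx => ?_
  · ext x
    simp only [mem_comp_domain, and_assoc]
    exact and_congr_right fun hxA => and_congr_right fun hAx => by
      rw [val_comp (mem_comp_domain.2 ⟨hxA, hAx⟩)]
  · obtain ⟨hxA, hAx⟩ := mem_comp_domain.1 hx
    have hxBA : x ∈ (comp B A).domain := mem_comp_domain.2 ⟨hxA, (mem_comp_domain.1 hAx).1⟩
    have hBAx : val (comp B A) x ∈ C.domain := by
      rw [val_comp hxBA]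
      exact (mem_comp_domain.1 hAx).2
    rw [val_comp hx, val_comp hAx, val_comp (mem_comp_domain.2 ⟨hxBA, hBAx⟩), val_comp hxBA]

theorem mem_npow_zero_domain (A : H →ₗ.[𝕜] H) (x : H) : x ∈ (npow A 0).domain :=
  Submodule.mem_top

theorem val_npow_zero (A : H →ₗ.[𝕜] H) (x : H) : val (npow A 0) x = x :=
  val_of_mem _ (mem_npow_zero_domain A x)

theorem npow_succ' (A : H →ₗ.[𝕜] H) (n : ℕ) : npow A (n + 1) = comp (npow A n) A := by
  induction n with
  | zero =>
    have hdom (x : H) : x ∈ (comp A (npow A 0)).domain ↔ x ∈ (comp (npow A 0) A).domain := by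
      simp only [mem_comp_domain, mem_npow_zero_domain, val_npow_zero, true_and, and_true]
    refine ext_val (Submodule.ext hdom) fun x hx => ?_
    change val (comp A (npow A 0)) x = val (comp (npow A 0) A) x
    rw [val_comp hx, val_comp ((hdom x).1 hx), val_npow_zero, val_npow_zero]
  | succ n ih =>
    calc npow A (n + 1 + 1) = comp A (comp (npow A n) A) := congrArg (comp A) ih
      _ = comp (npow A (n + 1)) A := (comp_assoc A (npow A n) A).symm

theorem mem_smoothVectors_iff {x : H} :
    x ∈ smoothVectors A ↔ x ∈ A.domain ∧ val A x ∈ smoothVectors A := by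
  simp only [smoothVectors, Submodule.mem_iInf]
  refine ⟨fun hx => ?_, fun ⟨hx, hAx⟩ n => ?_⟩
  · have hx' (n : ℕ) := mem_comp_domain.1 (npow_succ' A n ▸ hx (n + 1))
    exact ⟨(hx' 0).1, fun n => (hx' n).2⟩
  · cases n with
    | zero => exact mem_npow_zero_domain A x
    | succ n => exact npow_succ' A n ▸ mem_comp_domain.2 ⟨hx, hAx n⟩

theorem smoothVectors_le_domain (A : H →ₗ.[𝕜] H) : smoothVectors A ≤ A.domain :=
  fun _ hx => (mem_smoothVectors_iff.1 hx).1

theorem smoothVectors_le_npow_domain (A : H →ₗ.[𝕜] H) (n : ℕ) :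
    smoothVectors A ≤ (npow A n).domain :=
  iInf_le _ n

/-- The restriction of `A` to its smooth vectors: an everywhere defined endomorphism, on which
polynomials act without domain conditions. -/
def smoothMap (A : H →ₗ.[𝕜] H) : Module.End 𝕜 (smoothVectors A) :=
  (A.toFun ∘ₗ Submodule.inclusion (smoothVectors_le_domain A)).codRestrict _ fun x => by
    have hx := mem_smoothVectors_iff.1 x.2
    rw [val_of_mem A hx.1] at hx
    exact hx.2

theorem coe_smoothMap (x : smoothVectors A) : (smoothMap A x : H) = val A x :=
  (val_of_mem A (smoothVectors_le_domain A x.2)).symm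

theorem val_npow_coe (n : ℕ) (x : smoothVectors A) :
    val (npow A n) x = ((smoothMap A ^ n) x : smoothVectors A) := by
  induction n with
  | zero => exact val_npow_zero A x
  | succ n ih =>
    rw [npow, val_comp (smoothVectors_le_npow_domain A (n + 1) x.2), ih, pow_succ',
      Module.End.mul_apply, coe_smoothMap]

theorem exists_sum_apply_eq {ι : Type*} (s : Finset ι) (F : ι → H →ₗ.[𝕜] H) {x : H}
    (hx : ∀ i ∈ s, x ∈ (F i).domain) :
    ∃ h : x ∈ (∑ i ∈ s, F i).domain, (∑ i ∈ s, F i) ⟨x, h⟩ = ∑ i ∈ s, val (F i) x := by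
  classical
  induction s using Finset.induction_on with
  | empty => exact ⟨Submodule.mem_top, rfl⟩
  | insert i s hi ih =>
    obtain ⟨h, hsum⟩ := ih fun j hj => hx j (Finset.mem_insert_of_mem hj)
    have hxi := hx i (Finset.mem_insert_self i s)
    rw [Finset.sum_insert hi, Finset.sum_insert hi, val_of_mem _ hxi, ← hsum]
    exact ⟨⟨hxi, h⟩, rfl⟩

theorem exists_polyOp_apply_eq_aeval (p : ℝ[X]) (x : smoothVectors A) :
    ∃ h : (x : H) ∈ (polyOp p A).domain,
      polyOp p A ⟨x, h⟩ = (aeval (smoothMap A) (p.map (algebraMap ℝ 𝕜)) x : smoothVectors A) := by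
  have hmem (k : ℕ) : (x : H) ∈ (((p.coeff k : ℝ) : 𝕜) • npow A k).domain :=
    smoothVectors_le_npow_domain A k x.2
  obtain ⟨h, hsum⟩ := exists_sum_apply_eq p.support _ fun k _ => hmem k
  refine ⟨h, hsum.trans ?_⟩
  rw [aeval_def, eval₂_map, eval₂_eq_sum, Polynomial.sum, LinearMap.sum_apply,
    AddSubmonoidClass.coe_finsetSum]
  refine Finset.sum_congr rfl fun k _ => ?_
  rw [val_of_mem _ (hmem k), LinearPMap.smul_apply,
    ← val_of_mem _ (smoothVectors_le_npow_domain A k x.2), val_npow_coe]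
  simp

end Powers

section SelfAdjoint

variable {𝕜 : Type*} [RCLike 𝕜] {H : Type*} [NormedAddCommGroup H] [InnerProductSpace 𝕜 H]
  [CompleteSpace H] {A : H →ₗ.[𝕜] H}

theorem inner_val_left (hA : IsSelfAdjoint A) {x y : H} (hx : x ∈ A.domain) (hy : y ∈ A.domain) :
    inner 𝕜 (val A x) y = inner 𝕜 x (val A y) := by
  have h := LinearPMap.adjoint_isFormalAdjoint hA.dense_domain
  rw [LinearPMap.isSelfAdjoint_def.1 hA] at h
  rw [val_of_mem A hx, val_of_mem A hy]
  exact h ⟨x, hx⟩ ⟨y, hy⟩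

theorem mem_domain_and_val_eq_of_inner (hA : IsSelfAdjoint A) {y z : H}
    (h : ∀ u ∈ A.domain, inner 𝕜 z u = inner 𝕜 y (val A u)) : y ∈ A.domain ∧ val A y = z := by
  have hadj : ∃ w, ∀ u : A.domain, inner 𝕜 w (u : H) = inner 𝕜 y (A u) :=
    ⟨z, fun u => by rw [h u u.2, val_of_mem A u.2]⟩
  have hy : y ∈ A.domain := by
    have := LinearPMap.mem_adjoint_domain_of_exists y hadj
    rwa [LinearPMap.isSelfAdjoint_def.1 hA] at this
  refine ⟨hy, hA.dense_domain.eq_of_inner_left 𝕜 fun u hu => ?_⟩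
  rw [inner_val_left hA hy hu, h u hu]

theorem isClosed_ker (hA : IsSelfAdjoint A) : IsClosed (ker A : Set H) := by
  have hgraph : (ker A : Set H) = (fun x => (x, (0 : H))) ⁻¹' (A.graph : Set (H × H)) := by
    ext x
    simp [ker, LinearPMap.mem_graph_iff]
  rw [hgraph]
  exact hA.isClosed.preimage (by fun_prop)

theorem val_mem_ker_orthogonal (hA : IsSelfAdjoint A) {x : H} (hx : x ∈ A.domain) :
    val A x ∈ (ker A)ᗮ := by
  intro z hz
  obtain ⟨hzA, hz0⟩ := mem_ker_iff.1 hz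
  rw [← inner_val_left hA hzA hx, hz0, inner_zero_left]

theorem ker_npow_le (hA : IsSelfAdjoint A) (n : ℕ) : ker (npow A n) ≤ ker A := by
  induction n with
  | zero =>
    intro x hx
    have hx0 := (mem_ker_iff.1 hx).2
    rw [val_npow_zero] at hx0
    exact hx0 ▸ (ker A).zero_mem
  | succ n ih =>
    intro x hx
    rw [npow_succ', mem_ker_iff] at hx
    obtain ⟨hxA, hAx⟩ := mem_comp_domain.1 hx.1
    have hAx_ker : val A x ∈ ker A := ih (mem_ker_iff.2 ⟨hAx, by rw [← val_comp hx.1, hx.2]⟩)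
    exact mem_ker_iff.2 ⟨hxA, (Submodule.disjoint_def.1 (ker A).orthogonal_disjoint) _ hAx_ker
      (val_mem_ker_orthogonal hA hxA)⟩

end SelfAdjoint

section Resolvent

variable {𝕜 : Type*} [RCLike 𝕜] {H : Type*} [NormedAddCommGroup H] [InnerProductSpace 𝕜 H]
  {A : H →ₗ.[𝕜] H} {t : ℝ}

theorem re_inner_val_nonneg (hpos : IsNonneg A) {x : H} (hx : x ∈ A.domain) :
    0 ≤ RCLike.re (inner 𝕜 x (val A x)) := by
  rw [val_of_mem A hx]
  exact hpos ⟨x, hx⟩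

theorem sq_add_sq_norm_val_le (hpos : IsNonneg A) (ht : 0 ≤ t) {x : H} (hx : x ∈ A.domain) :
    (t * ‖x‖) ^ 2 + ‖val A x‖ ^ 2 ≤ ‖(t : 𝕜) • x + val A x‖ ^ 2 := by
  rw [@norm_add_sq 𝕜, inner_smul_left, norm_smul, RCLike.conj_ofReal, RCLike.re_ofReal_mul,
    RCLike.norm_ofReal, abs_of_nonneg ht]
  linarith [mul_nonneg ht (re_inner_val_nonneg hpos hx)]

theorem norm_val_le (hpos : IsNonneg A) (ht : 0 ≤ t) {x : H} (hx : x ∈ A.domain) :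
    ‖val A x‖ ≤ ‖(t : 𝕜) • x + val A x‖ :=
  le_of_sq_le_sq ((le_add_of_nonneg_left (sq_nonneg _)).trans
    (sq_add_sq_norm_val_le hpos ht hx)) (norm_nonneg _)

theorem mul_norm_le (hpos : IsNonneg A) (ht : 0 ≤ t) {x : H} (hx : x ∈ A.domain) :
    t * ‖x‖ ≤ ‖(t : 𝕜) • x + val A x‖ :=
  le_of_sq_le_sq ((le_add_of_nonneg_right (sq_nonneg _)).trans
    (sq_add_sq_norm_val_le hpos ht hx)) (norm_nonneg _)

theorem eq_zero_of_smul_add_val_eq_zero (hpos : IsNonneg A) (ht : 0 < t) {x : H}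
    (hx : x ∈ A.domain) (h : (t : 𝕜) • x + val A x = 0) : x = 0 := by
  have hle := mul_norm_le hpos ht.le hx
  rw [h, norm_zero] at hle
  exact norm_le_zero_iff.1 (nonpos_of_mul_nonpos_right hle ht)

theorem mem_domain_and_val_resolventPart (hpos : IsNonneg A) (ht : 0 < t) {x : H}
    (hx : x ∈ A.domain) :
    (t : 𝕜) • x + val A x ∈ (resolventPart A t).domain ∧
      val (resolventPart A t) ((t : 𝕜) • x + val A x) = val A x := by
  set T : H →ₗ.[𝕜] H := ((t : 𝕜) • (LinearMap.id : H →ₗ[𝕜] H)) +ᵥ A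
  have hT (y : A.domain) : T y = (t : 𝕜) • (y : H) + val A y := by
    rw [val_of_mem A y.2]
    rfl
  have hker : LinearMap.ker T.toFun = ⊥ := LinearMap.ker_eq_bot'.2 fun y hy =>
    Subtype.ext (eq_zero_of_smul_add_val_eq_zero hpos ht y.2 ((hT y).symm.trans hy))
  have hmem : (t : 𝕜) • x + val A x ∈ T.inverse.domain := by
    rw [LinearPMap.inverse_domain]
    exact ⟨⟨x, hx⟩, hT ⟨x, hx⟩⟩
  have hval : val T.inverse ((t : 𝕜) • x + val A x) = x := by
    rw [val_of_mem _ hmem]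
    exact LinearPMap.inverse_apply_eq hker (x := ⟨x, hx⟩) (hT ⟨x, hx⟩)
  have hmem' : (t : 𝕜) • x + val A x ∈ (resolventPart A t).domain :=
    mem_comp_domain.2 ⟨hmem, by rwa [hval]⟩
  exact ⟨hmem', by rw [resolventPart, val_comp hmem', hval]⟩

variable [CompleteSpace H]

theorem isClosed_map_graph (hA : IsSelfAdjoint A) (hpos : IsNonneg A) (ht : 0 < t) :
    IsClosed (A.graph.map ((t : 𝕜) • LinearMap.fst 𝕜 H H + LinearMap.snd 𝕜 H H) : Set H) := by
  have : CompleteSpace A.graph := hA.isClosed.completeSpace_coe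
  let L : A.graph →L[𝕜] H :=
    ((t : 𝕜) • ContinuousLinearMap.fst 𝕜 H H + ContinuousLinearMap.snd 𝕜 H H) ∘L A.graph.subtypeL
  have hL : AntilipschitzWith (max t⁻¹ 1).toNNReal L := by
    refine AddMonoidHomClass.antilipschitz_of_bound L ?_
    rintro ⟨⟨x, y⟩, hxy⟩
    obtain ⟨hx, rfl⟩ : ∃ hx : x ∈ A.domain, A ⟨x, hx⟩ = y := by
      simpa [LinearPMap.mem_graph_iff] using hxy
    change max ‖x‖ ‖A ⟨x, hx⟩‖ ≤ (max t⁻¹ 1).toNNReal * ‖(t : 𝕜) • x + A ⟨x, hx⟩‖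
    rw [← val_of_mem A hx, Real.coe_toNNReal _ (le_max_of_le_right zero_le_one)]
    refine max_le ?_ ?_
    · calc ‖x‖ = t⁻¹ * (t * ‖x‖) := by rw [inv_mul_cancel_left₀ ht.ne']
        _ ≤ _ := by gcongr; exacts [le_max_left _ _, mul_norm_le hpos ht.le hx]
    · calc ‖val A x‖ = 1 * ‖val A x‖ := (one_mul _).symm
        _ ≤ _ := by gcongr; exacts [le_max_right _ _, norm_val_le hpos ht.le hx]
  convert hL.isClosed_range L.uniformContinuous
  ext x
  simp [L]

theorem exists_smul_add_val_eq (hA : IsSelfAdjoint A) (hpos : IsNonneg A) (ht : 0 < t) (x : H) :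
    ∃ y ∈ A.domain, (t : 𝕜) • y + val A y = x := by
  set V := A.graph.map ((t : 𝕜) • LinearMap.fst 𝕜 H H + LinearMap.snd 𝕜 H H)
  have hV {y : H} : y ∈ V ↔ ∃ z ∈ A.domain, (t : 𝕜) • z + val A z = y := by
    simp only [V, Submodule.mem_map, LinearMap.add_apply, LinearMap.smul_apply,
      LinearMap.fst_apply, LinearMap.snd_apply, LinearPMap.mem_graph_iff']
    constructor
    · rintro ⟨-, ⟨z, rfl⟩, rfl⟩
      exact ⟨z, z.2, by rw [val_of_mem A z.2]⟩
    · rintro ⟨z, hz, rfl⟩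
      exact ⟨_, ⟨⟨z, hz⟩, rfl⟩, by rw [val_of_mem A hz]⟩
  have : CompleteSpace V := (isClosed_map_graph hA hpos ht).completeSpace_coe
  have htop : V = ⊤ := by
    rw [← Submodule.orthogonal_eq_bot_iff, Submodule.eq_bot_iff]
    intro w hw
    obtain ⟨hwA, hAw⟩ := mem_domain_and_val_eq_of_inner hA (y := w) (z := -((t : 𝕜) • w))
      fun u hu => by
        have horth := Submodule.inner_left_of_mem_orthogonal (hV.2 ⟨u, hu, rfl⟩) hw
        rw [inner_add_right, inner_smul_right] at horth
        rw [inner_neg_left, inner_smul_left, RCLike.conj_ofReal]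
        exact neg_eq_of_add_eq_zero_right horth
    exact eq_zero_of_smul_add_val_eq_zero hpos ht hwA (by rw [hAw, add_neg_cancel])
  exact hV.1 (htop ▸ Submodule.mem_top)

theorem mem_resolventPart_domain (hA : IsSelfAdjoint A) (hpos : IsNonneg A) (ht : 0 < t) (x : H) :
    x ∈ (resolventPart A t).domain := by
  obtain ⟨y, hy, rfl⟩ := exists_smul_add_val_eq hA hpos ht x
  exact (mem_domain_and_val_resolventPart hpos ht hy).1

theorem exists_val_resolventPart_eq (hA : IsSelfAdjoint A) (hpos : IsNonneg A) (ht : 0 < t)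
    (x : H) :
    ∃ y ∈ A.domain, (t : 𝕜) • y + val A y = x ∧ val (resolventPart A t) x = val A y := by
  obtain ⟨y, hy, rfl⟩ := exists_smul_add_val_eq hA hpos ht x
  exact ⟨y, hy, rfl, (mem_domain_and_val_resolventPart hpos ht hy).2⟩

theorem norm_val_resolventPart_le (hA : IsSelfAdjoint A) (hpos : IsNonneg A) (ht : 0 < t) (x : H) :
    ‖val (resolventPart A t) x‖ ≤ ‖x‖ := by
  obtain ⟨y, hy, rfl, hval⟩ := exists_val_resolventPart_eq hA hpos ht x
  rw [hval]
  exact norm_val_le hpos ht.le hy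

theorem sq_norm_val_resolventPart_le_re_inner (hA : IsSelfAdjoint A) (hpos : IsNonneg A)
    (ht : 0 < t) (x : H) :
    ‖val (resolventPart A t) x‖ ^ 2 ≤ RCLike.re (inner 𝕜 x (val (resolventPart A t) x)) := by
  obtain ⟨y, hy, rfl, hval⟩ := exists_val_resolventPart_eq hA hpos ht x
  rw [hval, inner_add_left, inner_smul_left, RCLike.conj_ofReal, map_add, RCLike.re_ofReal_mul,
    inner_self_eq_norm_sq]
  exact le_add_of_nonneg_left (mul_nonneg ht.le (re_inner_val_nonneg hpos hy))

theorem ker_resolventPart_le (hA : IsSelfAdjoint A) (hpos : IsNonneg A) (ht : 0 < t) :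
    ker (resolventPart A t) ≤ ker A := by
  intro x hx
  obtain ⟨y, hy, rfl, hval⟩ := exists_val_resolventPart_eq hA hpos ht x
  have hAy : val A y = 0 := hval.symm.trans (mem_ker_iff.1 hx).2
  rw [hAy, add_zero]
  exact (ker A).smul_mem _ (mem_ker_iff.2 ⟨hy, hAy⟩)

theorem mem_domain_and_val_val_resolventPart (hA : IsSelfAdjoint A) (hpos : IsNonneg A)
    (ht : 0 < t) {x : H} (hx : x ∈ A.domain) :
    val (resolventPart A t) x ∈ A.domain ∧
      val A (val (resolventPart A t) x) = val (resolventPart A t) (val A x) := by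
  obtain ⟨y, hy, rfl, hval⟩ := exists_val_resolventPart_eq hA hpos ht x
  have hAy : val A y ∈ A.domain := (Submodule.add_mem_iff_right _ (A.domain.smul_mem _ hy)).1 hx
  rw [hval, val_add A (A.domain.smul_mem _ hy) hAy, val_smul A _ hy,
    (mem_domain_and_val_resolventPart hpos ht hAy).2]
  exact ⟨hAy, rfl⟩

theorem mul_norm_val_resolventPart_le (hA : IsSelfAdjoint A) (hpos : IsNonneg A) (ht : 0 < t)
    {x : H} (hx : x ∈ A.domain) : t * ‖val (resolventPart A t) x‖ ≤ ‖val A x‖ := by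
  obtain ⟨y, hy, rfl, hval⟩ := exists_val_resolventPart_eq hA hpos ht x
  have hAy : val A y ∈ A.domain := (Submodule.add_mem_iff_right _ (A.domain.smul_mem _ hy)).1 hx
  rw [hval, val_add A (A.domain.smul_mem _ hy) hAy, val_smul A _ hy]
  exact mul_norm_le hpos ht.le hAy

theorem norm_val_resolventPart_sub_le (hA : IsSelfAdjoint A) (hpos : IsNonneg A) {s : ℝ}
    (hs : 0 < s) (ht : 0 < t) (x : H) :
    ‖val (resolventPart A t) x - val (resolventPart A s) x‖ ≤ |t - s| * (‖x‖ / s) := by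
  obtain ⟨y, hy, hyx, hty⟩ := exists_val_resolventPart_eq hA hpos ht x
  obtain ⟨z, hz, hzx, hsz⟩ := exists_val_resolventPart_eq hA hpos hs x
  have hshift : (t : 𝕜) • (y - z) + val A (y - z) = ((s - t : ℝ) : 𝕜) • z := by
    rw [val_sub A hy hz, smul_sub, RCLike.ofReal_sub, sub_smul, sub_add_sub_comm, hyx, ← hzx]
    abel
  calc ‖val (resolventPart A t) x - val (resolventPart A s) x‖ = ‖val A (y - z)‖ := by
        rw [hty, hsz, val_sub A hy hz]
    _ ≤ ‖((s - t : ℝ) : 𝕜) • z‖ := hshift ▸ norm_val_le hpos ht.le (A.domain.sub_mem hy hz)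
    _ = |t - s| * ‖z‖ := by rw [norm_smul, RCLike.norm_ofReal, abs_sub_comm]
    _ ≤ |t - s| * (‖x‖ / s) := by
        gcongr
        rw [le_div_iff₀' hs, ← hzx]
        exact mul_norm_le hpos hs.le hz

theorem continuousOn_val_resolventPart (hA : IsSelfAdjoint A) (hpos : IsNonneg A) (x : H) :
    ContinuousOn (fun t => val (resolventPart A t) x) (Set.Ioi 0) := by
  intro s hs
  have hlim : Tendsto (fun t : ℝ => |t - s| * (‖x‖ / s)) (𝓝[Set.Ioi 0] s) (𝓝 0) := by
    have hcont : Continuous fun t : ℝ => |t - s| * (‖x‖ / s) := by fun_prop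
    simpa using (hcont.tendsto s).mono_left nhdsWithin_le_nhds
  rw [ContinuousWithinAt, tendsto_iff_norm_sub_tendsto_zero]
  refine squeeze_zero' (Eventually.of_forall fun _ => norm_nonneg _) ?_ hlim
  filter_upwards [self_mem_nhdsWithin] with t ht
  exact norm_val_resolventPart_sub_le hA hpos hs ht x

end Resolvent

section FractionalPowers

variable {𝕜 : Type*} [RCLike 𝕜] {H : Type*} [NormedAddCommGroup H] [InnerProductSpace 𝕜 H]
  {A : H →ₗ.[𝕜] H} {α : ℝ}

theorem norm_balakrishnanIntegrand {t : ℝ} (ht : 0 < t) (x : H) :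
    ‖balakrishnanIntegrand A α x t‖ = t ^ (α - 1) * ‖val (resolventPart A t) x‖ := by
  rw [balakrishnanIntegrand, norm_smul, RCLike.norm_ofReal, abs_of_pos (Real.rpow_pos_of_pos ht _)]

theorem re_inner_balakrishnanIntegrand (t : ℝ) (x : H) :
    RCLike.re (inner 𝕜 x (balakrishnanIntegrand A α x t)) =
      t ^ (α - 1) * RCLike.re (inner 𝕜 x (val (resolventPart A t) x)) := by
  rw [balakrishnanIntegrand, inner_smul_right, RCLike.re_ofReal_mul]

theorem exists_tendsto_and_val_fracPow_eq {x : H} (hx : x ∈ (fracPow A α).domain) :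
    ∃ y, Tendsto (balakrishnanIntegral A α x) atTop (𝓝 y) ∧
      val (fracPow A α) x = ((Real.sin (Real.pi * α) / Real.pi : ℝ) : 𝕜) • y := by
  obtain ⟨y, hy⟩ := hx.2.2
  refine ⟨y, hy, ?_⟩
  rw [val_of_mem _ hx, ← hy.limUnder_eq]
  rfl

variable [CompleteSpace H]

theorem aestronglyMeasurable_balakrishnanIntegrand (hA : IsSelfAdjoint A) (hpos : IsNonneg A)
    (x : H) {s : Set ℝ} (hs : MeasurableSet s) (hs0 : s ⊆ Set.Ioi 0) :
    AEStronglyMeasurable (balakrishnanIntegrand A α x) (volume.restrict s) := by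
  refine (ContinuousOn.smul ?_ ?_).aestronglyMeasurable hs
  · exact RCLike.continuous_ofReal.comp_continuousOn
      (continuousOn_id.rpow_const fun t ht => Or.inl (hs0 ht).ne')
  · exact (continuousOn_val_resolventPart hA hpos x).mono hs0

theorem integrableOn_Ioc_balakrishnanIntegrand (hA : IsSelfAdjoint A) (hpos : IsNonneg A)
    (hα : 0 < α) (x : H) (R : ℝ) : IntegrableOn (balakrishnanIntegrand A α x) (Set.Ioc 0 R) := by
  have hrpow : IntegrableOn (fun t : ℝ => t ^ (α - 1) * ‖x‖) (Set.Ioc 0 R) :=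
    (intervalIntegral.intervalIntegrable_rpow' (by linarith)).1.mul_const _
  refine hrpow.mono' (aestronglyMeasurable_balakrishnanIntegrand hA hpos x measurableSet_Ioc
    Set.Ioc_subset_Ioi_self) ?_
  filter_upwards [ae_restrict_mem measurableSet_Ioc] with t ht
  rw [norm_balakrishnanIntegrand ht.1]
  exact mul_le_mul_of_nonneg_left (norm_val_resolventPart_le hA hpos ht.1 x)
    (Real.rpow_nonneg ht.1.le _)

theorem integrableOn_Ioi_balakrishnanIntegrand (hA : IsSelfAdjoint A) (hpos : IsNonneg A)
    (hα : 0 < α) (hα1 : α < 1) {x : H} (hx : x ∈ A.domain) :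
    IntegrableOn (balakrishnanIntegrand A α x) (Set.Ioi 0) := by
  rw [← Set.Ioc_union_Ioi_eq_Ioi (zero_le_one' ℝ)]
  refine (integrableOn_Ioc_balakrishnanIntegrand hA hpos hα x 1).union ?_
  have hrpow : IntegrableOn (fun t : ℝ => t ^ (α - 2) * ‖val A x‖) (Set.Ioi 1) :=
    (integrableOn_Ioi_rpow_of_lt (by linarith) one_pos).mul_const _
  refine hrpow.mono' (aestronglyMeasurable_balakrishnanIntegrand hA hpos x measurableSet_Ioi
    (Set.Ioi_subset_Ioi zero_le_one)) ?_
  filter_upwards [ae_restrict_mem measurableSet_Ioi] with t ht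
  have ht0 : 0 < t := zero_lt_one.trans ht
  rw [norm_balakrishnanIntegrand ht0, show α - 1 = α - 2 + 1 by ring, Real.rpow_add_one ht0.ne',
    mul_assoc]
  gcongr
  exact mul_norm_val_resolventPart_le hA hpos ht0 hx

theorem domain_le_fracPow_domain (hA : IsSelfAdjoint A) (hpos : IsNonneg A) (hα : 0 < α)
    (hα1 : α < 1) : A.domain ≤ (fracPow A α).domain := fun x hx => by
  let _ : NormedSpace ℝ H := NormedSpace.restrictScalars ℝ 𝕜 H
  refine ⟨fun t ht => mem_resolventPart_domain hA hpos ht x,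
    integrableOn_Ioc_balakrishnanIntegrand hA hpos hα x,
    ∫ t in Set.Ioi 0, balakrishnanIntegrand A α x t, ?_⟩
  refine (intervalIntegral_tendsto_integral_Ioi 0
    (integrableOn_Ioi_balakrishnanIntegrand hA hpos hα hα1 hx) tendsto_id).congr' ?_
  filter_upwards [eventually_ge_atTop 0] with R hR
  exact intervalIntegral.integral_of_le hR

theorem inner_balakrishnanIntegral (hA : IsSelfAdjoint A) (hpos : IsNonneg A) (hα : 0 < α)
    (u x : H) (R : ℝ) :
    inner 𝕜 u (balakrishnanIntegral A α x R) =
      ∫ t in Set.Ioc 0 R, inner 𝕜 u (balakrishnanIntegrand A α x t) := by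
  let _ : NormedSpace ℝ H := NormedSpace.restrictScalars ℝ 𝕜 H
  have : IsScalarTower ℝ 𝕜 H := RestrictScalars.isScalarTower ℝ 𝕜 H
  exact (integral_inner (integrableOn_Ioc_balakrishnanIntegrand hA hpos hα x R) u).symm

theorem inner_val_balakrishnanIntegral (hA : IsSelfAdjoint A) (hpos : IsNonneg A) (hα : 0 < α)
    {u x : H} (hu : u ∈ A.domain) (hx : x ∈ A.domain) (R : ℝ) :
    inner 𝕜 (val A u) (balakrishnanIntegral A α x R) =
      inner 𝕜 u (balakrishnanIntegral A α (val A x) R) := by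
  rw [inner_balakrishnanIntegral hA hpos hα, inner_balakrishnanIntegral hA hpos hα]
  refine setIntegral_congr_fun measurableSet_Ioc fun t ht => ?_
  obtain ⟨hmem, hcomm⟩ := mem_domain_and_val_val_resolventPart hA hpos ht.1 hx
  simp only [balakrishnanIntegrand, inner_smul_right]
  rw [inner_val_left hA hu hmem, hcomm]

theorem mem_domain_and_val_val_fracPow (hA : IsSelfAdjoint A) (hpos : IsNonneg A) (hα : 0 < α)
    (hα1 : α < 1) {x : H} (hx : x ∈ A.domain) (hAx : val A x ∈ A.domain) :
    val (fracPow A α) x ∈ A.domain ∧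
      val A (val (fracPow A α) x) = val (fracPow A α) (val A x) := by
  have hle := domain_le_fracPow_domain hA hpos hα hα1
  obtain ⟨y, hy, hxy⟩ := exists_tendsto_and_val_fracPow_eq (hle hx)
  obtain ⟨z, hz, hAxz⟩ := exists_tendsto_and_val_fracPow_eq (hle hAx)
  refine mem_domain_and_val_eq_of_inner hA fun u hu => ?_
  have hinner : inner 𝕜 u z = inner 𝕜 (val A u) y :=
    tendsto_nhds_unique (tendsto_const_nhds.inner hz) <|
      (tendsto_const_nhds.inner hy).congr fun R =>
        inner_val_balakrishnanIntegral hA hpos hα hu hx R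
  rw [hxy, hAxz, inner_smul_left, inner_smul_left, ← inner_conj_symm z, hinner, inner_conj_symm]

theorem integrableOn_re_inner_balakrishnanIntegrand (hA : IsSelfAdjoint A) (hpos : IsNonneg A)
    (hα : 0 < α) (x : H) (R : ℝ) :
    IntegrableOn (fun t => RCLike.re (inner 𝕜 x (balakrishnanIntegrand A α x t)))
      (Set.Ioc 0 R) :=
  ((integrableOn_Ioc_balakrishnanIntegrand hA hpos hα x R).const_inner x).re

theorem re_inner_balakrishnanIntegral (hA : IsSelfAdjoint A) (hpos : IsNonneg A) (hα : 0 < α)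
    (x : H) (R : ℝ) :
    RCLike.re (inner 𝕜 x (balakrishnanIntegral A α x R)) =
      ∫ t in Set.Ioc 0 R, RCLike.re (inner 𝕜 x (balakrishnanIntegrand A α x t)) := by
  rw [inner_balakrishnanIntegral hA hpos hα]
  exact (integral_re ((integrableOn_Ioc_balakrishnanIntegrand hA hpos hα x R).const_inner x)).symm

theorem monotone_re_inner_balakrishnanIntegral (hA : IsSelfAdjoint A) (hpos : IsNonneg A)
    (hα : 0 < α) (x : H) :
    Monotone fun R => RCLike.re (inner 𝕜 x (balakrishnanIntegral A α x R)) := by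
  intro R S hRS
  simp only [re_inner_balakrishnanIntegral hA hpos hα]
  refine setIntegral_mono_set (integrableOn_re_inner_balakrishnanIntegrand hA hpos hα x S) ?_
    (Set.Ioc_subset_Ioc_right hRS).eventuallyLE
  filter_upwards [ae_restrict_mem measurableSet_Ioc] with t ht
  rw [re_inner_balakrishnanIntegrand]
  exact mul_nonneg (Real.rpow_nonneg ht.1.le _)
    ((sq_nonneg _).trans (sq_norm_val_resolventPart_le_re_inner hA hpos ht.1 x))

theorem re_inner_balakrishnanIntegral_pos (hA : IsSelfAdjoint A) (hpos : IsNonneg A) (hα : 0 < α)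
    {x : H} (hx : x ∉ ker A) {R : ℝ} (hR : 0 < R) :
    0 < RCLike.re (inner 𝕜 x (balakrishnanIntegral A α x R)) := by
  rw [re_inner_balakrishnanIntegral hA hpos hα, ← intervalIntegral.integral_of_le hR.le]
  refine intervalIntegral.intervalIntegral_pos_of_pos_on
    ((intervalIntegrable_iff_integrableOn_Ioc_of_le hR.le).2
      (integrableOn_re_inner_balakrishnanIntegrand hA hpos hα x R)) (fun t ht => ?_) hR
  have hne : val (resolventPart A t) x ≠ 0 := fun h => hx <|
    ker_resolventPart_le hA hpos ht.1 (mem_ker_iff.2 ⟨mem_resolventPart_domain hA hpos ht.1 x, h⟩)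
  rw [re_inner_balakrishnanIntegrand]
  exact mul_pos (Real.rpow_pos_of_pos ht.1 _) ((pow_pos (norm_pos_iff.2 hne) 2).trans_le
    (sq_norm_val_resolventPart_le_re_inner hA hpos ht.1 x))

theorem ker_fracPow_le (hA : IsSelfAdjoint A) (hpos : IsNonneg A) (hα : 0 < α) (hα1 : α < 1) :
    ker (fracPow A α) ≤ ker A := by
  intro x hx
  obtain ⟨hxα, hx0⟩ := mem_ker_iff.1 hx
  obtain ⟨y, hy, hxy⟩ := exists_tendsto_and_val_fracPow_eq hxα
  have hsin : 0 < Real.sin (Real.pi * α) := Real.sin_pos_of_pos_of_lt_pi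
    (mul_pos Real.pi_pos hα) (mul_lt_of_lt_one_right Real.pi_pos hα1)
  have hy0 : y = 0 := by
    rw [hx0, eq_comm, smul_eq_zero, RCLike.ofReal_eq_zero] at hxy
    exact hxy.resolve_left (div_pos hsin Real.pi_pos).ne'
  have hlim : Tendsto (fun R => RCLike.re (inner 𝕜 x (balakrishnanIntegral A α x R))) atTop
      (𝓝 0) := by
    simpa [hy0, Function.comp_def] using (RCLike.continuous_re.tendsto _).comp
      ((tendsto_const_nhds (x := x)).inner (𝕜 := 𝕜) hy)
  -- `re ⟪x, ·⟫` of the truncated integrals is nondecreasing and positive off `ker A`, so it cannot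
  -- tend to `0`.
  by_contra hxA
  exact (re_inner_balakrishnanIntegral_pos hA hpos hα hxA one_pos).not_ge
    ((monotone_re_inner_balakrishnanIntegral hA hpos hα x).ge_of_tendsto hlim 1)

end FractionalPowers

section RealPowers

variable {𝕜 : Type*} [RCLike 𝕜] {H : Type*} [NormedAddCommGroup H] [InnerProductSpace 𝕜 H]
  {A B : H →ₗ.[𝕜] H}

theorem mem_comp_npow_domain_and_val (hB : smoothVectors A ≤ B.domain) (n : ℕ)
    (x : smoothVectors A) :
    (x : H) ∈ (comp B (npow A n)).domain ∧
      val (comp B (npow A n)) x = val B ((smoothMap A ^ n) x : smoothVectors A) := by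
  have hx : (x : H) ∈ (comp B (npow A n)).domain := by
    rw [mem_comp_domain, val_npow_coe]
    exact ⟨smoothVectors_le_npow_domain A n x.2, hB (Subtype.prop _)⟩
  exact ⟨hx, by rw [val_comp hx, val_npow_coe]⟩

variable [CompleteSpace H]

theorem smoothVectors_le_fracPow_domain (hA : IsSelfAdjoint A) (hpos : IsNonneg A) {s : ℝ}
    (hs : Int.fract s ≠ 0) : smoothVectors A ≤ (fracPow A (Int.fract s)).domain :=
  (smoothVectors_le_domain A).trans <| domain_le_fracPow_domain hA hpos
    ((Int.fract_nonneg s).lt_of_ne' hs) (Int.fract_lt_one s)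

theorem smoothVectors_le_rpow_domain (hA : IsSelfAdjoint A) (hpos : IsNonneg A) (s : ℝ) :
    smoothVectors A ≤ (rpow A s).domain := fun x hx => by
  rw [rpow]
  split_ifs with hs
  · exact smoothVectors_le_npow_domain A _ hx
  · exact (mem_comp_npow_domain_and_val
      (smoothVectors_le_fracPow_domain hA hpos hs) _ ⟨x, hx⟩).1

theorem mem_domain_and_val_val_rpow (hA : IsSelfAdjoint A) (hpos : IsNonneg A) (s : ℝ)
    (x : smoothVectors A) :
    val (rpow A s) x ∈ A.domain ∧
      val A (val (rpow A s) x) = val (rpow A s) (smoothMap A x : smoothVectors A) := by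
  have hcomm (n : ℕ) : smoothMap A ((smoothMap A ^ n) x) = (smoothMap A ^ n) (smoothMap A x) := by
    rw [← Module.End.mul_apply, ← Module.End.mul_apply, ← pow_succ', pow_succ]
  rw [rpow]
  split_ifs with hs
  · rw [val_npow_coe, val_npow_coe, ← hcomm, coe_smoothMap]
    exact ⟨smoothVectors_le_domain A (Subtype.prop _), rfl⟩
  · have hle := smoothVectors_le_fracPow_domain hA hpos hs
    rw [(mem_comp_npow_domain_and_val hle _ x).2, (mem_comp_npow_domain_and_val hle _ _).2,
      ← hcomm, coe_smoothMap]
    refine mem_domain_and_val_val_fracPow hA hpos ((Int.fract_nonneg s).lt_of_ne' hs)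
      (Int.fract_lt_one s) (smoothVectors_le_domain A (Subtype.prop _)) ?_
    rw [← coe_smoothMap]
    exact smoothVectors_le_domain A (Subtype.prop _)

theorem ker_rpow_le (hA : IsSelfAdjoint A) (hpos : IsNonneg A) (s : ℝ) :
    ker (rpow A s) ≤ ker A := by
  rw [rpow]
  split_ifs with hs
  · exact ker_npow_le hA _
  · intro x hx
    obtain ⟨hxs, hx0⟩ := mem_ker_iff.1 hx
    obtain ⟨hxn, hnx⟩ := mem_comp_domain.1 hxs
    have hker := ker_fracPow_le hA hpos ((Int.fract_nonneg s).lt_of_ne' hs) (Int.fract_lt_one s)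
      (mem_ker_iff.2 ⟨hnx, by rw [← val_comp hxs, hx0]⟩)
    obtain ⟨hnxA, hAnx⟩ := mem_ker_iff.1 hker
    have hmem : x ∈ (npow A (⌊s⌋₊ + 1)).domain := mem_comp_domain.2 ⟨hxn, hnxA⟩
    exact ker_npow_le hA (⌊s⌋₊ + 1) (mem_ker_iff.2 ⟨hmem, by rw [npow, val_comp hmem, hAnx]⟩)

/-- The restriction of `A ^ s` to the smooth vectors of `A`, an everywhere defined map on which the
minimisation defining the `θ`-iterates becomes a least squares problem in a Krylov space. -/
def smoothRpow (hA : IsSelfAdjoint A) (hpos : IsNonneg A) (s : ℝ) : smoothVectors A →ₗ[𝕜] H :=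
  (rpow A s).toFun ∘ₗ Submodule.inclusion (smoothVectors_le_rpow_domain hA hpos s)

theorem smoothRpow_apply (hA : IsSelfAdjoint A) (hpos : IsNonneg A) (s : ℝ)
    (x : smoothVectors A) : smoothRpow hA hpos s x = val (rpow A s) x :=
  (val_of_mem _ (smoothVectors_le_rpow_domain hA hpos s x.2)).symm

theorem inner_smoothRpow_smoothMap_left (hA : IsSelfAdjoint A) (hpos : IsNonneg A) (s : ℝ)
    (x y : smoothVectors A) :
    inner 𝕜 (smoothRpow hA hpos s (smoothMap A x)) (smoothRpow hA hpos s y) =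
      inner 𝕜 (smoothRpow hA hpos s x) (smoothRpow hA hpos s (smoothMap A y)) := by
  obtain ⟨hx, hAx⟩ := mem_domain_and_val_val_rpow hA hpos s x
  obtain ⟨hy, hAy⟩ := mem_domain_and_val_val_rpow hA hpos s y
  simp only [smoothRpow_apply]
  rw [← hAx, ← hAy, inner_val_left hA hx hy]

theorem coe_mem_ker_orthogonal_of_mem_krylovSubspace (hA : IsSelfAdjoint A)
    {e k : smoothVectors A} {N : ℕ} (hk : k ∈ krylovSubspace (smoothMap A) (smoothMap A e) N) :
    (k : H) ∈ (ker A)ᗮ := by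
  obtain ⟨q, -, rfl⟩ := hk
  have hcomm : aeval (smoothMap A) q (smoothMap A e) = smoothMap A (aeval (smoothMap A) q e) := by
    have h := congrArg (aeval (smoothMap A)) (mul_comm q X)
    rw [map_mul, map_mul, aeval_X] at h
    exact LinearMap.congr_fun h e
  change ((aeval (smoothMap A) q (smoothMap A e) : smoothVectors A) : H) ∈ _
  rw [hcomm, coe_smoothMap]
  exact val_mem_ker_orthogonal hA (smoothVectors_le_domain A (Subtype.prop _))

theorem disjoint_krylovSubspace_ker_smoothRpow (hA : IsSelfAdjoint A) (hpos : IsNonneg A) (s : ℝ)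
    (e : smoothVectors A) (N : ℕ) :
    Disjoint (krylovSubspace (smoothMap A) (smoothMap A e) N)
      (LinearMap.ker (smoothRpow hA hpos s)) := by
  refine Submodule.disjoint_def.2 fun k hk hk0 => ?_
  have hker : (k : H) ∈ ker A := ker_rpow_le hA hpos s <| mem_ker_iff.2
    ⟨smoothVectors_le_rpow_domain hA hpos s k.2, by rwa [← smoothRpow_apply hA hpos]⟩
  exact Subtype.ext <| Submodule.disjoint_def.1 (ker A).orthogonal_disjoint _ hker
    (coe_mem_ker_orthogonal_of_mem_krylovSubspace hA hk)

end RealPowers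

section SolutionManifold

variable {𝕜 : Type*} [RCLike 𝕜] {H : Type*} [NormedAddCommGroup H] [InnerProductSpace 𝕜 H]
  {A : H →ₗ.[𝕜] H} {g : H}

theorem mem_solutionSet_iff {x : H} : x ∈ solutionSet A g ↔ x ∈ A.domain ∧ val A x = g := by
  constructor
  · rintro ⟨hx, rfl⟩
    exact ⟨hx, val_of_mem A hx⟩
  · rintro ⟨hx, hxg⟩
    exact ⟨hx, (val_of_mem A hx).symm.trans hxg⟩

theorem sub_mem_ker_of_mem_solutionSet {x y : H} (hx : x ∈ solutionSet A g)
    (hy : y ∈ solutionSet A g) : x - y ∈ ker A := by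
  rw [mem_solutionSet_iff] at hx hy
  exact mem_ker_iff.2
    ⟨A.domain.sub_mem hx.1 hy.1, by rw [val_sub A hx.1 hy.1, hx.2, hy.2, sub_self]⟩

theorem proj_eq_of_sub_mem_ker_orthogonal {x p : H} (hp : p ∈ solutionSet A g)
    (hxp : x - p ∈ (ker A)ᗮ) : proj (solutionSet A g) x = p := by
  have orthogonal : ∀ q ∈ solutionSet A g, inner 𝕜 (x - p) (p - q) = 0 := fun q hq =>
    Submodule.inner_left_of_mem_orthogonal (sub_mem_ker_of_mem_solutionSet hp hq) hxp
  have hclosest : ∀ q ∈ solutionSet A g, ‖x - p‖ ≤ ‖x - q‖ := fun q hq => by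
    rw [← sub_add_sub_cancel x p q]
    exact norm_le_norm_add_of_inner_eq_zero (orthogonal q hq)
  obtain ⟨hmem, hle⟩ : proj (solutionSet A g) x ∈ solutionSet A g ∧
      ∀ q ∈ solutionSet A g, ‖x - proj (solutionSet A g) x‖ ≤ ‖x - q‖ :=
    Classical.epsilon_spec (p := fun y => y ∈ solutionSet A g ∧ ∀ q ∈ solutionSet A g,
      ‖x - y‖ ≤ ‖x - q‖) ⟨p, hp, hclosest⟩
  refine (sub_eq_zero.1 (eq_zero_of_norm_add_le_of_inner_eq_zero (orthogonal _ hmem) ?_)).symm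
  rw [sub_add_sub_cancel]
  exact hle p hp

variable [CompleteSpace H]

theorem exists_mem_solutionSet_sub_mem_ker_orthogonal (hA : IsSelfAdjoint A) (hg : g ∈ ran A)
    (x : H) : ∃ p ∈ solutionSet A g, x - p ∈ (ker A)ᗮ := by
  have : CompleteSpace (ker A) := (isClosed_ker hA).completeSpace_coe
  obtain ⟨y, rfl⟩ := hg
  set z := (ker A).starProjection (x - y)
  obtain ⟨hzA, hz0⟩ := mem_ker_iff.1 ((ker A).starProjection_apply_mem (x - y))
  refine ⟨y + z, mem_solutionSet_iff.2 ⟨A.domain.add_mem y.2 hzA, ?_⟩, ?_⟩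
  · rw [val_add A y.2 hzA, hz0, add_zero, val_of_mem A y.2]
    rfl
  · rw [← sub_sub]
    exact (ker A).sub_starProjection_mem_orthogonal (x - y)

theorem proj_mem_solutionSet (hA : IsSelfAdjoint A) (hg : g ∈ ran A) (x : H) :
    proj (solutionSet A g) x ∈ solutionSet A g := by
  obtain ⟨p, hp, hxp⟩ := exists_mem_solutionSet_sub_mem_ker_orthogonal hA hg x
  rwa [proj_eq_of_sub_mem_ker_orthogonal hp hxp]

theorem err_mem_ker_orthogonal (hA : IsSelfAdjoint A) (hg : g ∈ ran A) (x : H) :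
    err A g x ∈ (ker A)ᗮ := by
  obtain ⟨p, hp, hxp⟩ := exists_mem_solutionSet_sub_mem_ker_orthogonal hA hg x
  rwa [err, proj_eq_of_sub_mem_ker_orthogonal hp hxp]

theorem proj_add_of_mem_ker_orthogonal (hA : IsSelfAdjoint A) (hg : g ∈ ran A) (x : H) {k : H}
    (hk : k ∈ (ker A)ᗮ) : proj (solutionSet A g) (x + k) = proj (solutionSet A g) x := by
  refine proj_eq_of_sub_mem_ker_orthogonal (proj_mem_solutionSet hA hg x) ?_
  rw [add_sub_right_comm]
  exact add_mem (err_mem_ker_orthogonal hA hg x) hk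

theorem err_add_of_mem_ker_orthogonal (hA : IsSelfAdjoint A) (hg : g ∈ ran A) (x : H) {k : H}
    (hk : k ∈ (ker A)ᗮ) : err A g (x + k) = err A g x + k := by
  rw [err, proj_add_of_mem_ker_orthogonal hA hg x hk, add_sub_right_comm, err]

theorem err_mem_smoothVectors (hA : IsSelfAdjoint A) (hg : g ∈ ran A)
    (hg_smooth : g ∈ smoothVectors A) {x : H} (hx : x ∈ smoothVectors A) :
    err A g x ∈ smoothVectors A := by
  obtain ⟨hp, hAp⟩ := mem_solutionSet_iff.1 (proj_mem_solutionSet hA hg x)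
  exact sub_mem hx (mem_smoothVectors_iff.2 ⟨hp, hAp.symm ▸ hg_smooth⟩)

theorem val_err (hA : IsSelfAdjoint A) (hg : g ∈ ran A) {x : H} (hx : x ∈ A.domain) :
    val A (err A g x) = val A x - g := by
  obtain ⟨hp, hAp⟩ := mem_solutionSet_iff.1 (proj_mem_solutionSet hA hg x)
  rw [err, val_sub A hx hp, hAp]

end SolutionManifold

section ThetaIterates

variable {𝕜 : Type*} [RCLike 𝕜] {H : Type*} [NormedAddCommGroup H] [InnerProductSpace 𝕜 H]
  {A : H →ₗ.[𝕜] H} {g f₀ : H}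

theorem krylov_coe (x : smoothVectors A) (N : ℕ) :
    krylov A x N = (krylovSubspace (smoothMap A) x N).map (smoothVectors A).subtype := by
  rw [krylovSubspace_eq_span, Submodule.map_span, Set.image_image, krylov]
  congr 1
  ext v
  simp only [val_npow_coe, Set.mem_ofPred_eq, Set.mem_image, Set.mem_Iio, Submodule.subtype_apply,
    eq_comm (a := v)]

variable [CompleteSpace H]

theorem mem_searchSpace_iff (hA : IsSelfAdjoint A) (hg : g ∈ ran A) (hf₀ : f₀ ∈ A.domain)
    {e : smoothVectors A} (he : (e : H) = err A g f₀) {N : ℕ} {h : H} :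
    h ∈ searchSpace A g f₀ N ↔
      ∃ k ∈ krylovSubspace (smoothMap A) (smoothMap A e) N, h = f₀ + k := by
  rw [searchSpace, Set.mem_ofPred_eq, ← val_err hA hg hf₀, ← he, ← coe_smoothMap, krylov_coe,
    Submodule.mem_map]
  simp only [Submodule.subtype_apply, eq_sub_iff_add_eq', eq_comm (a := h)]

theorem isThetaIterates_iff (hA : IsSelfAdjoint A) (hpos : IsNonneg A) (hg : g ∈ ran A)
    (hf₀ : f₀ ∈ A.domain) {e : smoothVectors A} (he : (e : H) = err A g f₀) (θ : ℝ) {f : ℕ → H} :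
    IsThetaIterates A g f₀ θ f ↔ ∀ N, ∃ k : smoothVectors A,
      (k ∈ krylovSubspace (smoothMap A) (smoothMap A e) N ∧
        IsMinOn (fun k => ‖smoothRpow hA hpos (θ / 2) (e + k)‖)
          (krylovSubspace (smoothMap A) (smoothMap A e) N) k) ∧
      f N = f₀ + k := by
  have herr {N : ℕ} {k : smoothVectors A}
      (hk : k ∈ krylovSubspace (smoothMap A) (smoothMap A e) N) :
      err A g (f₀ + k) = (e + k : smoothVectors A) := by
    rw [err_add_of_mem_ker_orthogonal hA hg f₀
      (coe_mem_ker_orthogonal_of_mem_krylovSubspace hA hk), ← he, Submodule.coe_add]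
  have hmem {N : ℕ} {h : H} := mem_searchSpace_iff hA hg hf₀ he (N := N) (h := h)
  constructor
  · rintro ⟨hf0, hf⟩ N
    rcases N.eq_zero_or_pos with rfl | hN
    · refine ⟨0, ⟨zero_mem _, ?_⟩, by simpa using hf0⟩
      simp [krylovSubspace_zero, isMinOn_iff]
    · obtain ⟨-, hfN, hmin⟩ := hf N hN
      obtain ⟨k, hk, hfk⟩ := hmem.1 hfN
      refine ⟨k, ⟨hk, fun l hl => ?_⟩, hfk⟩
      have hle := hmin _ (hmem.2 ⟨l, hl, rfl⟩)
      rwa [hfk, herr hk, herr hl, ← smoothRpow_apply hA hpos, ← smoothRpow_apply hA hpos] at hle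
  · intro hf
    refine ⟨?_, fun N _ => ?_⟩
    · obtain ⟨k, ⟨hk, -⟩, hfk⟩ := hf 0
      rw [krylovSubspace_zero, Submodule.mem_bot] at hk
      rw [hfk, hk, Submodule.coe_zero, add_zero]
    · obtain ⟨k, ⟨hk, hmin⟩, hfk⟩ := hf N
      refine ⟨fun h hh => ?_, hmem.2 ⟨k, hk, hfk⟩, fun h hh => ?_⟩
      · obtain ⟨l, hl, rfl⟩ := hmem.1 hh
        exact herr hl ▸ smoothVectors_le_rpow_domain hA hpos _ (Subtype.prop _)
      · obtain ⟨l, hl, rfl⟩ := hmem.1 hh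
        rw [hfk, herr hk, herr hl, ← smoothRpow_apply hA hpos, ← smoothRpow_apply hA hpos]
        exact hmin hl

theorem exists_forall_isThetaIterates_iff_eq (hA : IsSelfAdjoint A) (hpos : IsNonneg A)
    (hg : g ∈ ran A) (hf₀ : f₀ ∈ A.domain) {e : smoothVectors A} (he : (e : H) = err A g f₀)
    (θ : ℝ) :
    ∃ k : ℕ → smoothVectors A,
      (∀ N, k N ∈ krylovSubspace (smoothMap A) (smoothMap A e) N ∧
        IsMinOn (fun k => ‖smoothRpow hA hpos (θ / 2) (e + k)‖)
          (krylovSubspace (smoothMap A) (smoothMap A e) N) (k N)) ∧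
      ∀ f, IsThetaIterates A g f₀ θ f ↔ f = fun N => f₀ + (k N : H) := by
  choose k hk hk_unique using fun N => existsUnique_isMinOn_norm_map_add _
    (disjoint_krylovSubspace_ker_smoothRpow hA hpos (θ / 2) e N) e
  refine ⟨k, hk, fun f => ?_⟩
  rw [isThetaIterates_iff hA hpos hg hf₀ he, funext_iff]
  exact forall_congr' fun N =>
    ⟨fun ⟨l, hl, hf⟩ => hk_unique N l hl ▸ hf, fun hf => ⟨k N, hk N, hf⟩⟩

theorem exists_add_eq_polyOp_apply_of_isMinOn (hA : IsSelfAdjoint A) (hpos : IsNonneg A) {s : ℝ}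
    {e k : smoothVectors A} {N : ℕ} (hk : k ∈ krylovSubspace (smoothMap A) (smoothMap A e) N)
    (hmin : IsMinOn (fun k => ‖smoothRpow hA hpos s (e + k)‖)
      (krylovSubspace (smoothMap A) (smoothMap A e) N) k) :
    ∃ p : ℝ[X], p.natDegree ≤ N ∧ p.eval 0 = 1 ∧
      ∃ h : (e : H) ∈ (polyOp p A).domain, (e + k : H) = polyOp p A ⟨e, h⟩ := by
  obtain ⟨p, hdeg, hp0, hpe⟩ := exists_real_polynomial_of_isMinOn
    (inner_smoothRpow_smoothMap_left hA hpos s)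
    (disjoint_krylovSubspace_ker_smoothRpow hA hpos s e N) hk hmin
  obtain ⟨h, hp⟩ := exists_polyOp_apply_eq_aeval p e
  exact ⟨p, hdeg, hp0, h, by rw [hp, hpe, Submodule.coe_add]⟩

end ThetaIterates

end UnboundedOp

end

theorem proposition2p1 {𝕜 : Type*} [RCLike 𝕜] {H : Type*} [NormedAddCommGroup H]
    [InnerProductSpace 𝕜 H] [CompleteSpace H] (A : H →ₗ.[𝕜] H) (hA : IsSelfAdjoint A)
    (hpos : UnboundedOp.IsNonneg A) (g f₀ : H) (hg : g ∈ UnboundedOp.ran A)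
    (hg_smooth : g ∈ UnboundedOp.smoothVectors A) (hf₀ : f₀ ∈ UnboundedOp.smoothVectors A)
    (θ : ℝ) (hθ : 0 ≤ θ) :
    (∃! f : ℕ → H, UnboundedOp.IsThetaIterates A g f₀ θ f) ∧
    ∀ f : ℕ → H, UnboundedOp.IsThetaIterates A g f₀ θ f →
      (∀ N : ℕ, f N - UnboundedOp.proj (UnboundedOp.solutionSet A g) (f N) ∈
        (UnboundedOp.ker A)ᗮ) ∧
      (∀ N : ℕ, 1 ≤ N → UnboundedOp.proj (UnboundedOp.solutionSet A g) (f N) =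
        UnboundedOp.proj (UnboundedOp.solutionSet A g) (f 0)) ∧
      (∀ N : ℕ, 1 ≤ N → ∃ p : Polynomial ℝ, p.natDegree ≤ N ∧ p.eval 0 = 1 ∧
        ∃ h : f 0 - UnboundedOp.proj (UnboundedOp.solutionSet A g) (f 0) ∈
            (UnboundedOp.polyOp p A).domain,
          f N - UnboundedOp.proj (UnboundedOp.solutionSet A g) (f N) =
            UnboundedOp.polyOp p A ⟨_, h⟩) := by
  obtain ⟨e, he⟩ : ∃ e : UnboundedOp.smoothVectors A, (e : H) = UnboundedOp.err A g f₀ :=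
    ⟨⟨_, UnboundedOp.err_mem_smoothVectors hA hg hg_smooth hf₀⟩, rfl⟩
  obtain ⟨k, hk, hiff⟩ := UnboundedOp.exists_forall_isThetaIterates_iff_eq hA hpos hg
    (UnboundedOp.smoothVectors_le_domain A hf₀) he θ
  refine ⟨⟨_, (hiff _).2 rfl, fun f => (hiff f).1⟩, fun f hf => ?_⟩
  obtain rfl : f 0 = f₀ := hf.1
  have hfN (N : ℕ) : f N = f 0 + k N := congrFun ((hiff f).1 hf) N
  have hk_orthogonal (N : ℕ) : (k N : H) ∈ (UnboundedOp.ker A)ᗮ :=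
    UnboundedOp.coe_mem_ker_orthogonal_of_mem_krylovSubspace hA (hk N).1
  have herr (N : ℕ) : UnboundedOp.err A g (f N) = UnboundedOp.err A g (f 0) + k N := by
    rw [hfN N, UnboundedOp.err_add_of_mem_ker_orthogonal hA hg _ (hk_orthogonal N)]
  refine ⟨fun N => UnboundedOp.err_mem_ker_orthogonal hA hg (f N), fun N _ => ?_, fun N _ => ?_⟩
  · rw [hfN N, UnboundedOp.proj_add_of_mem_ker_orthogonal hA hg _ (hk_orthogonal N)]
  · change ∃ p : Polynomial ℝ, _ ∧ _ ∧ ∃ h : UnboundedOp.err A g (f 0) ∈ _,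
      UnboundedOp.err A g (f N) = UnboundedOp.polyOp p A ⟨_, h⟩
    rw [herr N, ← he]
    exact UnboundedOp.exists_add_eq_polyOp_apply_of_isMinOn hA hpos (hk N).1 (hk N).2
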